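/- Let $k$ be a field and let $\Lambda$ be an associative unital $k$-algebra (not necessarily finite dimensional). For a $k$-algebra $A$ let $HH_n(A)=\mathrm{Tor}_n^{A\otimes_k A^{\mathrm{op}}}(A,A)$ denote its Hochschild homology. A \emph{system} of $\Lambda$ is a finite set $E\subset\Lambda$ of pairwise orthogonal (not necessarily primitive) idempotents with $\sum_{x\in E}x=1$; for $x\in E$, $x\Lambda x$ is regarded as a $k$-algebra with unit $x$. The Peirce $E$-quiver $Q_E$ has vertex set $E$ and, for $x\neq y$ in $E$, one arrow from $x$ to $y$ if $y\Lambda x\neq 0$ (and no other arrows). The algebra $\Lambda$ is \emph{$E$-triangular} if $E$ is non trivial (it has at least two elements) and $Q_E$ has no oriented cycles. If $\Lambda$ is $E$-triangular with respect to a system $E$, then there is a decomposition $$HH_*(\Lambda)\;\cong\;\bigoplus_{x\in E}HH_*(x\Lambda x),$$ that is, for every $n\ge 0$ there is an isomorphism of $k$-vector spaces $HH_n(\Lambda)\cong\bigoplus_{x\in E}HH_n(x\Lambda x)$. -/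

import Mathlib

open CategoryTheory
open scoped TensorProduct DirectSum

universe u v

noncomputable section

/-! ### Tensor products and `Tor` over a noncommutative `k`-algebra -/

section TorOver

variable (k : Type u) [Field k] (A : Type v) [Ring A]

section TensorOver

variable (M : Type v) [AddCommGroup M] [Module k M] [Module Aᵐᵒᵖ M]
variable (N : Type v) [AddCommGroup N] [Module k N] [Module A N]

/-- The subspace of `M ⊗[k] N` spanned by all `m·a ⊗ n - m ⊗ a·n`, where `M` is a right
`A`-module (a left `Aᵐᵒᵖ`-module) and `N` is a left `A`-module. -/
def balancedRel : Submodule k (M ⊗[k] N) :=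
  Submodule.span k {t | ∃ (m : M) (a : A) (n : N),
    t = (MulOpposite.op a • m) ⊗ₜ[k] n - m ⊗ₜ[k] (a • n)}

/-- The tensor product `M ⊗_A N` over the (noncommutative) `k`-algebra `A`, as a `k`-vector
space. -/
abbrev TensorOver : Type v := (M ⊗[k] N) ⧸ balancedRel k A M N

end TensorOver

/-- Linear maps on `M ⊗_A N` that agree on pure tensors are equal. -/
theorem TensorOver.hom_ext {M : Type v} [AddCommGroup M] [Module k M] [Module Aᵐᵒᵖ M]
    {N : Type v} [AddCommGroup N] [Module k N] [Module A N]
    {W : Type v} [AddCommGroup W] [Module k W] {f g : TensorOver k A M N →ₗ[k] W}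
    (h : ∀ (m : M) (n : N), f (Submodule.Quotient.mk (m ⊗ₜ[k] n)) =
      g (Submodule.Quotient.mk (m ⊗ₜ[k] n))) : f = g :=
  Submodule.linearMap_qext _ (TensorProduct.ext' h)

variable [Algebra k A]

/-- The map `M ⊗_A N → M ⊗_A N'` induced by an `A`-linear map `f : N → N'`. -/
def TensorOver.map (M : Type v) [AddCommGroup M] [Module k M] [Module Aᵐᵒᵖ M]
    {N N' : Type v} [AddCommGroup N] [Module k N] [Module A N] [IsScalarTower k A N]
    [AddCommGroup N'] [Module k N'] [Module A N'] [IsScalarTower k A N'] (f : N →ₗ[A] N') :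
    TensorOver k A M N →ₗ[k] TensorOver k A M N' :=
  Submodule.mapQ _ _ (LinearMap.lTensor M (f.restrictScalars k)) (by
    rw [balancedRel, Submodule.span_le]
    rintro _ ⟨m, a, n, rfl⟩
    simp only [Submodule.comap_coe, Set.mem_preimage, SetLike.mem_coe, map_sub,
      LinearMap.lTensor_tmul, LinearMap.coe_restrictScalars, map_smul]
    exact Submodule.subset_span ⟨m, a, f n, rfl⟩)

attribute [local instance] ModuleCat.moduleOfAlgebraModule
attribute [local instance] ModuleCat.isScalarTower_of_algebra_moduleCat

/-- The functor `M ⊗_A -` from left `A`-modules to `k`-vector spaces. A left `A`-module is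
a `k`-vector space through `k → A`. -/
def tensorFunctor (M : Type v) [AddCommGroup M] [Module k M] [Module Aᵐᵒᵖ M] :
    ModuleCat.{v} A ⥤ ModuleCat.{v} k where
  obj N := ModuleCat.of k (TensorOver k A M N)
  map f := ModuleCat.ofHom (TensorOver.map k A M f.hom)
  map_id _ := ModuleCat.hom_ext (TensorOver.hom_ext k A fun _ _ => rfl)
  map_comp _ _ := ModuleCat.hom_ext (TensorOver.hom_ext k A fun _ _ => rfl)

instance tensorFunctor_additive (M : Type v) [AddCommGroup M] [Module k M] [Module Aᵐᵒᵖ M] :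
    (tensorFunctor k A M).Additive where
  map_add {_ N' f g} := ModuleCat.hom_ext (TensorOver.hom_ext k A fun m n =>
    congrArg (Submodule.Quotient.mk (p := balancedRel k A M N'))
      (TensorProduct.tmul_add m (f.hom n) (g.hom n)))

/-- `Tor_n^A(M, N)` for a right `A`-module `M` and a left `A`-module `N`: the `n`-th left derived
functor of `M ⊗_A -`, evaluated at `N`. -/
def TorOver (M : Type v) [AddCommGroup M] [Module k M] [Module Aᵐᵒᵖ M]
    (N : ModuleCat.{v} A) (n : ℕ) : ModuleCat.{v} k :=
  ((tensorFunctor k A M).leftDerived n).obj N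

end TorOver

/-! ### Hochschild homology -/

section Hochschild

variable (k : Type u) [Field k] (Λ : Type v) [Ring Λ] [Algebra k Λ]

/-- The enveloping algebra `Λ ⊗ Λᵒᵖ`. -/
abbrev Env : Type v := Λ ⊗[k] Λᵐᵒᵖ

/-- `Λ` as a left `Λ ⊗ Λᵒᵖ`-module: `(a ⊗ b) • x = a * x * b`. -/
@[reducible] def leftEnvModule : Module (Env k Λ) Λ := instModuleTensorProductMop k Λ

/-- The right action of `Λ ⊗ Λᵒᵖ` on `Λ`, `x • (a ⊗ b) = b * x * a`. -/
def rightEnvAction : Env k Λ →ₐ[k] (Module.End k Λ)ᵐᵒᵖ :=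
  Algebra.TensorProduct.lift
    (AlgHom.opComm.symm (Algebra.lsmul k k Λ : Λᵐᵒᵖ →ₐ[k] Module.End k Λ))
    (AlgHom.op (Algebra.lmul k Λ))
    (fun a b => (commute_iff_eq _ _).mpr (by
      apply MulOpposite.unop_injective
      ext x
      simp [mul_assoc]))

/-- `Λ` as a right `Λ ⊗ Λᵒᵖ`-module. -/
@[reducible] def rightEnvModule : Module (Env k Λ)ᵐᵒᵖ Λ :=
  Module.compHom Λ (AlgHom.opComm (rightEnvAction k Λ)).toRingHom

theorem leftEnvModule_smul (a x : Λ) (b : Λᵐᵒᵖ) :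
    letI := leftEnvModule k Λ
    ((a ⊗ₜ[k] b : Env k Λ) • x) = a * x * b.unop :=
  AlgHom.mulLeftRight_apply k Λ a b x

theorem rightEnvModule_smul (a x : Λ) (b : Λᵐᵒᵖ) :
    letI := rightEnvModule k Λ
    (MulOpposite.op (a ⊗ₜ[k] b : Env k Λ) • x) = b.unop * x * a := by
  change (AlgHom.opComm (rightEnvAction k Λ) (MulOpposite.op (a ⊗ₜ[k] b))) x = _
  change (MulOpposite.unop (rightEnvAction k Λ (a ⊗ₜ[k] b))) x = _
  rw [rightEnvAction, Algebra.TensorProduct.lift_tmul]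
  simp [mul_assoc]

/-- The Hochschild homology `HH_n(Λ) = Tor_n^{Λ ⊗ Λᵒᵖ}(Λ, Λ)`, a `k`-vector space. -/
def HH (n : ℕ) : ModuleCat.{v} k :=
  letI := leftEnvModule k Λ
  letI := rightEnvModule k Λ
  TorOver k (Env k Λ) Λ (ModuleCat.of (Env k Λ) Λ) n

end Hochschild

/-! ### The algebras `xΛx` -/

section Corner

variable {k : Type u} [Field k] {Λ : Type v} [Ring Λ] [Algebra k Λ]

/-- The `k`-linear structure on `eΛe` inherited from `Λ`. -/
instance cornerModule {e : Λ} (he : IsIdempotentElem e) : Module k he.Corner where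
  smul c r := ⟨c • r.1, by
    obtain ⟨a, ha⟩ := r.2
    exact ⟨c • a, by simp [← ha]⟩⟩
  one_smul r := Subtype.ext (one_smul k r.1)
  mul_smul c d r := Subtype.ext (mul_smul c d r.1)
  smul_zero c := Subtype.ext (smul_zero c)
  smul_add c r s := Subtype.ext (smul_add c r.1 s.1)
  add_smul c d r := Subtype.ext (add_smul c d r.1)
  zero_smul r := Subtype.ext (zero_smul k r.1)

/-- For an idempotent `e`, the ring `eΛe` (with unit `e`) is a `k`-algebra. -/
instance cornerAlgebra {e : Λ} (he : IsIdempotentElem e) : Algebra k he.Corner :=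
  Algebra.ofModule (fun c r s => Subtype.ext (smul_mul_assoc c r.1 s.1))
    (fun c r s => Subtype.ext (mul_smul_comm c r.1 s.1))

end Corner

/-! ### Systems, Peirce quivers and triangular algebras -/

section Peirce

variable {Λ : Type v} [Ring Λ]

/-- A system of `Λ`: a finite set of pairwise orthogonal, not necessarily primitive, idempotents
with sum `1`. -/
abbrev IsSystem (E : Finset Λ) : Prop :=
  CompleteOrthogonalIdempotents (fun x : E => (x : Λ))

/-- The vertices of the Peirce `E`-quiver. -/
structure PeirceVertex (E : Finset Λ) where
  idem : Λ
  mem : idem ∈ E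

/-- The Peirce `E`-quiver: there is one arrow `x ⟶ y` if `x ≠ y` and `yΛx ≠ 0`, and none
otherwise. -/
instance peirceQuiver (E : Finset Λ) : Quiver.{0} (PeirceVertex E) where
  Hom x y := PLift (x ≠ y ∧ ∃ a : Λ, y.idem * a * x.idem ≠ 0)

/-- A quiver has no oriented cycles if every path from a vertex to itself has length zero. -/
def NoOrientedCycles (V : Type*) [Quiver V] : Prop :=
  ∀ (x : V) (p : Quiver.Path x x), p.length = 0

/-- `Λ` is `E`-triangular: `E` is non trivial and the Peirce `E`-quiver has no oriented cycles. -/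
def IsTriangular (E : Finset Λ) : Prop :=
  E.Nontrivial ∧ NoOrientedCycles (PeirceVertex E)

end Peirce

end

noncomputable section

section Resolution

open Limits

universe w w'

variable {C : Type w} [Category.{w'} C] [Abelian C]

section Splice

variable {X Y : ℕ → C} (p : ∀ n, X n ⟶ Y n) (i : ∀ n, Y (n + 1) ⟶ X n) (w : ∀ n, i n ≫ p n = 0)

/-- The complex obtained by splicing the sequences `Y (n + 1) ⟶ X n ⟶ Y n`. -/
def spliceComplex : ChainComplex C ℕ :=
  ChainComplex.of X (fun n => p (n + 1) ≫ i n) (fun n => by simp [reassoc_of% w (n + 1)])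

theorem spliceComplex_d (n : ℕ) :
    (spliceComplex p i w).d (n + 1) n = p (n + 1) ≫ i n :=
  ChainComplex.of_d X (fun n => p (n + 1) ≫ i n) n

theorem spliceComplex_d_comp : (spliceComplex p i w).d 1 0 ≫ p 0 = 0 := by
  have h : (p 1 ≫ i 0) ≫ p 0 = 0 := by rw [Category.assoc, w, comp_zero]
  exact (congrArg (· ≫ p 0) (spliceComplex_d p i w 0)).trans h

theorem exact_epi_comp {X₁ X₂ X₃ X₄ : C} (q : X₁ ⟶ X₂) (f : X₂ ⟶ X₃) (g : X₃ ⟶ X₄) [Epi q]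
    (w : f ≫ g = 0) (h : (ShortComplex.mk f g w).Exact) :
    (ShortComplex.mk (q ≫ f) g (by simp [w])).Exact := by
  let α : ShortComplex.mk (q ≫ f) g (by simp [w]) ⟶ ShortComplex.mk f g w :=
    { τ₁ := q
      τ₂ := 𝟙 _
      τ₃ := 𝟙 _ }
  rwa [ShortComplex.exact_iff_of_epi_of_isIso_of_mono α]

theorem exact_comp_mono {X₁ X₂ X₃ X₄ : C} (f : X₁ ⟶ X₂) (g : X₂ ⟶ X₃) (j : X₃ ⟶ X₄) [Mono j]
    (w : f ≫ g = 0) (h : (ShortComplex.mk f g w).Exact) :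
    (ShortComplex.mk f (g ≫ j) (by rw [reassoc_of% w, zero_comp])).Exact := by
  let α : ShortComplex.mk f g w ⟶ ShortComplex.mk f (g ≫ j) (by rw [reassoc_of% w, zero_comp]) :=
    { τ₁ := 𝟙 _
      τ₂ := 𝟙 _
      τ₃ := j }
  rwa [← ShortComplex.exact_iff_of_epi_of_isIso_of_mono α]

theorem spliceComplex_exactAt [∀ n, Epi (p n)] [∀ n, Mono (i n)]
    (h : ∀ n, (ShortComplex.mk (i n) (p n) (w n)).Exact) (n : ℕ) :
    (spliceComplex p i w).ExactAt (n + 1) := by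
  rw [HomologicalComplex.exactAt_iff' _ (n + 1 + 1) (n + 1) n (by simp) (by simp)]
  have hex := exact_comp_mono _ _ (i n) _ (exact_epi_comp (p (n + 2)) _ _ _ (h (n + 1)))
  convert hex using 1
  simp only [HomologicalComplex.sc', HomologicalComplex.shortComplexFunctor', spliceComplex_d]
  rfl

/-- The projective resolution obtained by splicing short exact sequences
`Y (n + 1) ⟶ X n ⟶ Y n` with `X n` projective. -/
def spliceResolution [∀ n, Epi (p n)] [∀ n, Mono (i n)]
    (h : ∀ n, (ShortComplex.mk (i n) (p n) (w n)).Exact) (hX : ∀ n, Projective (X n)) :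
    ProjectiveResolution (Y 0) where
  complex := spliceComplex p i w
  projective := hX
  π := (ChainComplex.toSingle₀Equiv _ _).symm ⟨p 0, spliceComplex_d_comp p i w⟩
  quasiIso := ⟨fun n => by
    cases n
    · rw [ChainComplex.quasiIsoAt₀_iff, ShortComplex.quasiIso_iff_of_zeros']
      · refine (ShortComplex.exact_and_epi_g_iff_of_iso ?_).2
          ⟨exact_epi_comp (p 1) _ _ _ (h 0), inferInstanceAs (Epi (p 0))⟩
        refine ShortComplex.isoMk (Iso.refl _) (Iso.refl _) (Iso.refl _) ?_ ?_
        · simp only [Iso.refl_hom]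
          erw [Category.id_comp, Category.comp_id]
          exact (spliceComplex_d p i w 0).symm
        · simp only [Iso.refl_hom]
          erw [Category.id_comp, Category.comp_id]
          exact (ChainComplex.toSingle₀Equiv_symm_apply_f_zero (C := spliceComplex p i w) (p 0)
            (spliceComplex_d_comp p i w)).symm
      all_goals rfl
    · rw [quasiIsoAt_iff_exactAt']
      · exact spliceComplex_exactAt p i w h _
      · exact ChainComplex.exactAt_succ_single_obj _ _⟩

end Splice

/-- The iterated syzygies of an object with respect to a choice of covers `p N : P N ⟶ N`. -/
def iteratedSyzygy (P : C → C) (p : ∀ N, P N ⟶ N) (Z : C) : ℕ → C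
  | 0 => Z
  | n + 1 => kernel (p (iteratedSyzygy P p Z n))

/-- The inclusion of a syzygy in the preceding cover. -/
def iteratedSyzygyι (P : C → C) (p : ∀ N, P N ⟶ N) (Z : C) (n : ℕ) :
    iteratedSyzygy P p Z (n + 1) ⟶ P (iteratedSyzygy P p Z n) :=
  kernel.ι (p (iteratedSyzygy P p Z n))

/-- If every object of a class `T` closed under subobjects is covered by a projective object
`P N` of `T`, then every object of `T` has a projective resolution by objects `P N`. -/
theorem exists_projectiveResolution_of_cover (T : C → Prop) (P : C → C) (p : ∀ N, P N ⟶ N)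
    (hP : ∀ N, Projective (P N)) (hT : ∀ N, T (P N)) (hp : ∀ N, T N → Epi (p N))
    (hsub : ∀ {M N : C} (i : M ⟶ N) [Mono i], T N → T M) (Z : C) (hZ : T Z) :
    ∃ R : ProjectiveResolution Z, ∀ n, ∃ N, R.complex.X n = P N := by
  have hT' : ∀ n, T (iteratedSyzygy P p Z n) := by
    rintro (_ | n)
    · exact hZ
    · exact hsub (M := kernel (p (iteratedSyzygy P p Z n))) (kernel.ι _) (hT _)
  have hepi : ∀ n, Epi (p (iteratedSyzygy P p Z n)) := fun n => hp _ (hT' n)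
  have hmono : ∀ n, Mono (iteratedSyzygyι P p Z n) := fun n =>
    equalizer.ι_mono (f := p (iteratedSyzygy P p Z n)) (g := 0)
  exact ⟨spliceResolution (fun n => p (iteratedSyzygy P p Z n)) (iteratedSyzygyι P p Z)
    (fun n => kernel.condition (p (iteratedSyzygy P p Z n)))
    (fun n => ShortComplex.exact_of_f_is_kernel _ (kernelIsKernel (p (iteratedSyzygy P p Z n))))
    (fun n => hP _), fun n => ⟨_, rfl⟩⟩

variable {D : Type*} [Category* D] [Abelian D]

/-- The image of a projective resolution under an exact functor that sends its terms to
projective objects. -/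
def CategoryTheory.ProjectiveResolution.mapExact {Z : C} (R : ProjectiveResolution Z) (G : C ⥤ D)
    [G.Additive] [G.PreservesHomology] (hG : ∀ n, Projective (G.obj (R.complex.X n))) :
    ProjectiveResolution (G.obj Z) where
  complex := (G.mapHomologicalComplex _).obj R.complex
  projective := hG
  π := (G.mapHomologicalComplex _).map R.π ≫
    (HomologicalComplex.singleMapHomologicalComplex G (ComplexShape.down ℕ) 0).hom.app Z
  quasiIso := inferInstance

end Resolution

section Peirce

variable {k : Type u} [Field k] {R S : Type v} [Ring R] [Ring S] [Algebra k R] [Algebra k S]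

/-- The Peirce component `φ(1)N` of an `R`-module `N`, where `φ : S → R` is a non-unital
algebra homomorphism. -/
def peirceSubgroup (φ : S →ₙₐ[k] R) (N : Type v) [AddCommGroup N] [Module R N] :
    AddSubgroup N where
  carrier := {n : N | φ 1 • n = n}
  add_mem' := fun {a b} (ha : _ = _) (hb : _ = _) => show _ = _ by rw [smul_add, ha, hb]
  zero_mem' := smul_zero _
  neg_mem' := fun {a} (ha : _ = _) => show _ = _ by rw [smul_neg, ha]

/-- The Peirce component `φ(1)N`, as a type. -/
abbrev PeirceComponent (φ : S →ₙₐ[k] R) (N : Type v) [AddCommGroup N] [Module R N] : Type v :=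
  peirceSubgroup φ N

namespace PeirceComponent

variable (φ : S →ₙₐ[k] R) {N N' : Type v} [AddCommGroup N] [Module R N]
  [AddCommGroup N'] [Module R N']

theorem smul_val (n : PeirceComponent φ N) : φ 1 • n.1 = n.1 := n.2

instance : Module S (PeirceComponent φ N) where
  smul s n := ⟨φ s • n.1, show _ = _ by rw [← mul_smul, ← map_mul, one_mul]⟩
  one_smul n := Subtype.ext n.2
  mul_smul s t n := Subtype.ext (by
    change φ (s * t) • n.1 = φ s • φ t • n.1
    rw [map_mul, mul_smul])
  smul_zero s := Subtype.ext (smul_zero (φ s))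
  smul_add s a b := Subtype.ext (smul_add (φ s) a.1 b.1)
  add_smul s t n := Subtype.ext (by
    change φ (s + t) • n.1 = φ s • n.1 + φ t • n.1
    rw [map_add, add_smul])
  zero_smul n := Subtype.ext (by
    change φ 0 • n.1 = 0
    rw [map_zero, zero_smul])

/-- The map induced on Peirce components by a linear map. -/
def map (f : N →ₗ[R] N') : PeirceComponent φ N →ₗ[S] PeirceComponent φ N' where
  toFun n := ⟨f n.1, show _ = _ by rw [← map_smul, smul_val]⟩
  map_add' a b := Subtype.ext (map_add f a.1 b.1)
  map_smul' s n := Subtype.ext (map_smul f (φ s) n.1)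

end PeirceComponent

/-- The functor sending an `R`-module `N` to the `S`-module `φ(1)N`. -/
def peirceFunctor (φ : S →ₙₐ[k] R) : ModuleCat.{v} R ⥤ ModuleCat.{v} S where
  obj N := ModuleCat.of S (PeirceComponent φ N)
  map f := ModuleCat.ofHom (PeirceComponent.map φ f.hom)

instance (φ : S →ₙₐ[k] R) : (peirceFunctor φ).Additive where

instance (φ : S →ₙₐ[k] R) : (peirceFunctor φ).PreservesHomology :=
  Functor.preservesHomology_of_map_exact _ fun K hK => by
    rw [ShortComplex.moduleCat_exact_iff] at hK ⊢
    rintro ⟨n, hn⟩ h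
    obtain ⟨m, hm⟩ := hK n (congrArg Subtype.val h)
    have he : φ 1 * φ 1 = φ 1 := by rw [← map_mul, one_mul]
    refine ⟨⟨φ 1 • m, show _ = _ by rw [← mul_smul, he]⟩, Subtype.ext ?_⟩
    change K.f.hom (φ 1 • m) = n
    rw [map_smul]
    erw [hm]
    exact hn

end Peirce

section Cover

variable {k : Type u} [Field k] {R S : Type v} [Ring R] [Ring S] [Algebra k R] [Algebra k S]
  {I : Type v} (e : I → R)

/-- The direct sum of the left ideals `R e_i`, for a family of idempotents `e_i` of `R`, as a
submodule of a free module. -/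
def idempotentSum : Submodule R (I →₀ R) where
  carrier := {f | ∀ i, f i * e i = f i}
  add_mem' hf hg i := by rw [Finsupp.add_apply, add_mul, hf i, hg i]
  zero_mem' i := by simp
  smul_mem' r f hf i := by rw [Finsupp.smul_apply, smul_eq_mul, mul_assoc, hf i]

/-- The direct sum of the left ideals `R e_i`, as a type. -/
def IdempotentSum : Type v := idempotentSum e

instance : AddCommGroup (IdempotentSum e) := inferInstanceAs (AddCommGroup (idempotentSum e))

instance : Module R (IdempotentSum e) := inferInstanceAs (Module R (idempotentSum e))

/-- Componentwise right multiplication by the family `e`. -/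
def mulRightFamily : (I →₀ R) →ₗ[R] (I →₀ R) where
  toFun f := Finsupp.onFinset f.support (fun i => f i * e i) fun i h => by
    rw [Finsupp.mem_support_iff]
    rintro h'
    simp [h'] at h
  map_add' f g := by ext i; simp [add_mul]
  map_smul' r f := by ext i; simp [mul_assoc]

@[simp]
theorem mulRightFamily_apply (f : I →₀ R) (i : I) : mulRightFamily e f i = f i * e i := rfl

variable {e}

theorem mulRightFamily_mem (he : ∀ i, IsIdempotentElem (e i)) (f : I →₀ R) :
    mulRightFamily e f ∈ idempotentSum e := fun i => by
  rw [mulRightFamily_apply, mul_assoc, he i]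

theorem idempotentSum_projective (he : ∀ i, IsIdempotentElem (e i)) :
    Module.Projective R (IdempotentSum e) :=
  Module.Projective.of_split (P := idempotentSum e) (idempotentSum e).subtype
    ((mulRightFamily e).codRestrict _ (mulRightFamily_mem he))
    (LinearMap.ext fun f => Subtype.ext (Finsupp.ext fun i => f.2 i))

theorem peirceComponent_idempotentSum_projective (he : ∀ i, IsIdempotentElem (e i))
    (φ : S →ₙₐ[k] R) (ψ : R →ₗ[k] S) (hψφ : ∀ s, ψ (φ s) = s)
    (hφψ : ∀ r, φ (ψ r) = φ 1 * r * φ 1)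
    (horth : ∀ i, e i = φ 1 ∨ ∀ r, φ 1 * r * e i = 0) :
    Module.Projective S (PeirceComponent φ (IdempotentSum e)) := by
  change Module.Projective S (PeirceComponent φ (idempotentSum e))
  have hφ : Function.Injective φ := Function.LeftInverse.injective hψφ
  have hψ : ∀ s r, ψ (φ s * r) = s * ψ r := fun s r => hφ (by
    rw [map_mul φ, hφψ, hφψ, ← mul_assoc, ← mul_assoc, ← mul_assoc, ← map_mul, ← map_mul,
      one_mul, mul_one])
  have hsplit : ∀ i r, r * e i = r → φ 1 * r = r → φ (ψ r) * e i = r := by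
    intro i r h1 h2
    rcases horth i with h | h
    · rw [hφψ, h2, ← h, h1, h1]
    · have hr : r = 0 := by rw [← h1, ← h2, h]
      rw [hr, map_zero, map_zero, zero_mul]
  let s : PeirceComponent φ (idempotentSum e) →ₗ[S] (I →₀ S) :=
    { toFun := fun f => Finsupp.mapRange ψ (map_zero ψ) f.1.1
      map_add' := fun f g => by
        ext i
        exact map_add ψ _ _
      map_smul' := fun a f => by
        ext i
        exact hψ a (f.1.1 i) }
  let r : (I →₀ S) →ₗ[S] PeirceComponent φ (idempotentSum e) :=
    { toFun := fun g => ⟨⟨mulRightFamily e (Finsupp.mapRange φ (map_zero φ) g),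
        mulRightFamily_mem he _⟩, Subtype.ext (Finsupp.ext fun i => by
          change φ 1 * (φ (g i) * e i) = φ (g i) * e i
          rw [← mul_assoc, ← map_mul, one_mul])⟩
      map_add' := fun f g => Subtype.ext (Subtype.ext (Finsupp.ext fun i => by
        change φ (f i + g i) * e i = φ (f i) * e i + φ (g i) * e i
        rw [map_add, add_mul]))
      map_smul' := fun a g => Subtype.ext (Subtype.ext (Finsupp.ext fun i => by
        change φ (a * g i) * e i = φ a * (φ (g i) * e i)
        rw [map_mul, mul_assoc])) }
  refine Module.Projective.of_split s r (LinearMap.ext fun f => Subtype.ext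
    (Subtype.ext (Finsupp.ext fun i => ?_)))
  exact hsplit i _ (f.1.2 i) (DFunLike.congr_fun (congrArg Subtype.val f.2) i)

/-- The linear map from the direct sum of the `R e_i` to a module given by a family of vectors. -/
def idempotentSumLift {N : Type v} [AddCommGroup N] [Module R N] (v : I → N) :
    IdempotentSum e →ₗ[R] N :=
  Finsupp.linearCombination R v ∘ₗ (idempotentSum e).subtype

theorem smul_mem_range_idempotentSumLift {N : Type v} [AddCommGroup N] [Module R N] (v : I → N)
    (he : ∀ i, IsIdempotentElem (e i)) (i : I) :
    e i • v i ∈ LinearMap.range (idempotentSumLift (e := e) v) := by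
  classical
  refine ⟨⟨Finsupp.single i (e i), fun j => ?_⟩, ?_⟩
  · rcases eq_or_ne i j with rfl | h
    · simpa using (he i).eq
    · simp [h.symm]
  · exact (Finsupp.linearCombination_single R (e i) i)

end Cover

section EnvCorner

variable (k : Type u) [Field k] {A Λ : Type v} [Ring A] [Algebra k A] [Ring Λ] [Algebra k Λ]

/-- The map induced by a linear map on opposite spaces. -/
def opLinearMap {V W : Type v} [AddCommGroup V] [Module k V] [AddCommGroup W] [Module k W]
    (f : V →ₗ[k] W) : Vᵐᵒᵖ →ₗ[k] Wᵐᵒᵖ :=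
  (MulOpposite.opLinearEquiv k).toLinearMap ∘ₗ f ∘ₗ (MulOpposite.opLinearEquiv k).symm.toLinearMap

/-- The linear map of enveloping algebras induced by a linear map. -/
def envLinearMap (f : A →ₗ[k] Λ) : Env k A →ₗ[k] Env k Λ :=
  TensorProduct.map f (opLinearMap k f)

theorem envLinearMap_tmul (f : A →ₗ[k] Λ) (a : A) (b : Aᵐᵒᵖ) :
    envLinearMap k f (a ⊗ₜ b) = f a ⊗ₜ MulOpposite.op (f b.unop) := rfl

variable {k}

/-- The non-unital homomorphism of enveloping algebras induced by a non-unital algebra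
homomorphism. -/
def envMap (f : A →ₙₐ[k] Λ) : Env k A →ₙₐ[k] Env k Λ where
  __ := envLinearMap k (f : A →ₗ[k] Λ)
  map_zero' := map_zero (envLinearMap k (f : A →ₗ[k] Λ))
  map_mul' s t := by
    change envLinearMap k (f : A →ₗ[k] Λ) (s * t) =
      envLinearMap k (f : A →ₗ[k] Λ) s * envLinearMap k (f : A →ₗ[k] Λ) t
    induction s using TensorProduct.induction_on with
    | zero => rw [zero_mul, map_zero, zero_mul]
    | add a b ha hb => rw [add_mul, map_add, map_add, add_mul, ha, hb]
    | tmul a b =>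
      induction t using TensorProduct.induction_on with
      | zero => rw [mul_zero, map_zero, mul_zero]
      | add c d hc hd => rw [mul_add, map_add, map_add, mul_add, hc, hd]
      | tmul c d =>
        simp only [Algebra.TensorProduct.tmul_mul_tmul, envLinearMap_tmul, MulOpposite.unop_mul,
          ← MulOpposite.op_mul]
        exact congrArg₂ (fun x y => x ⊗ₜ[k] MulOpposite.op y) (map_mul f a c)
          (map_mul f d.unop b.unop)

theorem envMap_tmul (f : A →ₙₐ[k] Λ) (a : A) (b : Aᵐᵒᵖ) :
    envMap f (a ⊗ₜ b) = f a ⊗ₜ MulOpposite.op (f b.unop) := rfl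

theorem envMap_one (f : A →ₙₐ[k] Λ) : envMap f 1 = f 1 ⊗ₜ MulOpposite.op (f 1) := rfl

theorem envLinearMap_envMap {f : A →ₙₐ[k] Λ} {p : Λ →ₗ[k] A} (hpf : ∀ a, p (f a) = a)
    (s : Env k A) : envLinearMap k p (envMap f s) = s := by
  induction s using TensorProduct.induction_on with
  | zero => rw [map_zero, map_zero]
  | add a b ha hb => rw [map_add, map_add, ha, hb]
  | tmul a b =>
    rw [envMap_tmul, envLinearMap_tmul, hpf, MulOpposite.unop_op, hpf, MulOpposite.op_unop]

theorem envMap_envLinearMap {f : A →ₙₐ[k] Λ} {p : Λ →ₗ[k] A} (hfp : ∀ b, f (p b) = f 1 * b * f 1)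
    (r : Env k Λ) : envMap f (envLinearMap k p r) = envMap f 1 * r * envMap f 1 := by
  induction r using TensorProduct.induction_on with
  | zero => rw [map_zero, map_zero, mul_zero, zero_mul]
  | add a b ha hb => rw [map_add, map_add, ha, hb, mul_add, add_mul]
  | tmul a b =>
    rw [envMap_one, Algebra.TensorProduct.tmul_mul_tmul,
      Algebra.TensorProduct.tmul_mul_tmul, envLinearMap_tmul, envMap_tmul, hfp,
      MulOpposite.unop_op, hfp, MulOpposite.op_mul, MulOpposite.op_mul, MulOpposite.op_unop,
      mul_assoc (MulOpposite.op (f 1))]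

end EnvCorner

section Triangular

variable (k : Type u) [Field k] {Λ : Type v} [Ring Λ] [Algebra k Λ] {E : Finset Λ}

/-- A relation on a system for which `Λ` is triangular: it is transitive and antisymmetric, and
`x ≤ y` whenever `xΛy ≠ 0`. -/
structure IsPeirceOrder (le : E → E → Prop) : Prop where
  trans : ∀ {x y z}, le x y → le y z → le x z
  antisymm : ∀ {x y}, le x y → le y x → x = y
  of_ne_zero : ∀ {x y : E} (a : Λ), (x : Λ) * a * y ≠ 0 → le x y

theorem IsTriangular.exists_isPeirceOrder (hΛ : IsTriangular E) :
    ∃ le : E → E → Prop, IsPeirceOrder le := by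
  let V : E → PeirceVertex E := fun x => ⟨x.1, x.2⟩
  refine ⟨fun x y => Nonempty (Quiver.Path (V y) (V x)), ?_, ?_, ?_⟩
  · rintro x y z ⟨p⟩ ⟨q⟩
    exact ⟨q.comp p⟩
  · rintro x y ⟨p⟩ ⟨q⟩
    have h := hΛ.2 _ (p.comp q)
    rw [Quiver.Path.length_comp] at h
    have h' := Quiver.Path.eq_of_length_zero p (by omega)
    exact Subtype.ext (congrArg PeirceVertex.idem h').symm
  · intro x y a h
    by_cases hxy : V y = V x
    · rw [hxy]
      exact ⟨Quiver.Path.nil⟩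
    · exact ⟨Quiver.Hom.toPath ⟨⟨hxy, a, h⟩⟩⟩

/-- The element `x ⊗ y` of the enveloping algebra. -/
def peirceElt (x y : E) : Env k Λ := (x : Λ) ⊗ₜ MulOpposite.op (y : Λ)

theorem peirceElt_isIdempotentElem (hE : IsSystem E) (x y : E) :
    IsIdempotentElem (peirceElt k x y) := by
  rw [IsIdempotentElem, peirceElt, Algebra.TensorProduct.tmul_mul_tmul, (hE.idem x).eq,
    ← MulOpposite.op_mul, (hE.idem y).eq]

theorem sum_peirceElt (hE : IsSystem E) : ∑ p : E × E, peirceElt k p.1 p.2 = 1 := by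
  rw [Fintype.sum_prod_type]
  have h : ∑ y : E, MulOpposite.op (y : Λ) = 1 := by
    rw [← Finset.op_sum, hE.complete, MulOpposite.op_one]
  simp only [peirceElt]
  simp_rw [← TensorProduct.tmul_sum, h, ← TensorProduct.sum_tmul, hE.complete]
  rfl

theorem peirceElt_mul_mul {le : E → E → Prop} (hle : IsPeirceOrder le) {x y z w : E}
    (h : ¬ (le z x ∧ le y w)) (r : Env k Λ) : peirceElt k z w * r * peirceElt k x y = 0 := by
  induction r using TensorProduct.induction_on with
  | zero => rw [mul_zero, zero_mul]
  | add a b ha hb => rw [mul_add, add_mul, ha, hb, add_zero]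
  | tmul a b =>
    rw [peirceElt, peirceElt, Algebra.TensorProduct.tmul_mul_tmul,
      Algebra.TensorProduct.tmul_mul_tmul]
    by_cases h1 : le z x
    · have h2 : (y : Λ) * b.unop * w = 0 := by
        by_contra h3
        exact h ⟨h1, hle.of_ne_zero _ h3⟩
      have h3 : MulOpposite.op (w : Λ) * b * MulOpposite.op (y : Λ) = 0 :=
        MulOpposite.unop_injective (by simpa [mul_assoc] using h2)
      rw [h3, TensorProduct.tmul_zero]
    · have h2 : (z : Λ) * a * x = 0 := by
        by_contra h3
        exact h1 (hle.of_ne_zero _ h3)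
      rw [h2, TensorProduct.zero_tmul]

/-- A bimodule `N` is triangular with respect to `le` if `xNy ≠ 0` only for `x ≤ y`. -/
def IsTriangularModule (le : E → E → Prop) (N : Type v) [AddCommGroup N]
    [Module (Env k Λ) N] : Prop :=
  ∀ x y : E, ¬ le x y → ∀ n : N, peirceElt k x y • n = 0

theorem IsPeirceOrder.isTriangularModule_self {le : E → E → Prop} (hle : IsPeirceOrder le) :
    letI := leftEnvModule k Λ
    IsTriangularModule k le Λ := by
  intro x y h n
  rw [peirceElt, leftEnvModule_smul]
  by_contra h'
  exact h (hle.of_ne_zero _ h')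

/-- The index set of the triangular cover of `N`. -/
abbrev TriangularCoverIndex (le : E → E → Prop) (N : Type v) : Type v :=
  {p : E × E // le p.1 p.2} × N

/-- The sum of the projective bimodules `Λx ⊗ yΛ`, with `x ≤ y`, indexed by the elements of `N`. -/
abbrev triangularCover (le : E → E → Prop) (N : Type v) : Type v :=
  IdempotentSum (R := Env k Λ) fun i : TriangularCoverIndex le N => peirceElt k i.1.1.1 i.1.1.2

theorem triangularCover_isTriangularModule {le : E → E → Prop} (hle : IsPeirceOrder le)
    (N : Type v) : IsTriangularModule k le (triangularCover k le N) := by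
  intro z w h f
  refine Subtype.ext (Finsupp.ext fun i => ?_)
  change peirceElt k z w * f.1 i = 0
  rw [← f.2 i, ← mul_assoc]
  exact peirceElt_mul_mul k hle
    (fun h' => h (hle.trans h'.1 (hle.trans i.1.2 h'.2))) _

variable {A : E → Type v} [∀ z, Ring (A z)] [∀ z, Algebra k (A z)]

theorem peirceComponent_triangularCover_projective (hE : IsSystem E) {le : E → E → Prop}
    (hle : IsPeirceOrder le) {f : ∀ z, A z →ₙₐ[k] Λ} {p : ∀ z, Λ →ₗ[k] A z}
    (hf : ∀ z, f z 1 = z) (hpf : ∀ z a, p z (f z a) = a) (hfp : ∀ z b, f z (p z b) = z * b * z)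
    (N : Type v) (z : E) :
    Module.Projective (Env k (A z)) (PeirceComponent (envMap (f z)) (triangularCover k le N)) := by
  refine peirceComponent_idempotentSum_projective
    (fun i => peirceElt_isIdempotentElem k hE _ _) _ (envLinearMap k (p z))
    (envLinearMap_envMap (hpf z))
    (envMap_envLinearMap fun b => by rw [hfp, hf]) fun i => ?_
  rw [envMap_one, hf]
  by_cases h : le z i.1.1.1 ∧ le i.1.1.2 z
  · have h1 := hle.antisymm h.1 (hle.trans i.1.2 h.2)
    have h2 := hle.antisymm (hle.trans h.1 i.1.2) h.2
    left
    rw [← h1, ← h2]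
    rfl
  · right
    exact fun r => peirceElt_mul_mul k hle h r

/-- The covering map of a triangular bimodule. -/
def triangularCoverMap (le : E → E → Prop) (N : Type v) [AddCommGroup N] [Module (Env k Λ) N] :
    triangularCover k le N →ₗ[Env k Λ] N :=
  idempotentSumLift Prod.snd

theorem triangularCoverMap_surjective (hE : IsSystem E) {le : E → E → Prop} {N : Type v}
    [AddCommGroup N] [Module (Env k Λ) N] (hN : IsTriangularModule k le N) :
    Function.Surjective (triangularCoverMap k le N) := by
  rw [← LinearMap.range_eq_top, eq_top_iff]
  rintro n -
  rw [← one_smul (Env k Λ) n, ← sum_peirceElt k hE, Finset.sum_smul]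
  refine Submodule.sum_mem _ fun p _ => ?_
  by_cases h : le p.1 p.2
  · exact smul_mem_range_idempotentSumLift (e := fun i : TriangularCoverIndex le N =>
      peirceElt k i.1.1.1 i.1.1.2) Prod.snd
      (fun i => peirceElt_isIdempotentElem k hE _ _) (⟨p, h⟩, n)
  · rw [hN _ _ h]
    exact Submodule.zero_mem _

/-- A triangular bimodule has a projective resolution by triangular bimodules, whose Peirce
components are projective. -/
theorem exists_triangular_resolution (hE : IsSystem E) {le : E → E → Prop}
    (hle : IsPeirceOrder le) {f : ∀ z, A z →ₙₐ[k] Λ} {p : ∀ z, Λ →ₗ[k] A z}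
    (hf : ∀ z, f z 1 = z) (hpf : ∀ z a, p z (f z a) = a) (hfp : ∀ z b, f z (p z b) = z * b * z)
    (Z : ModuleCat.{v} (Env k Λ)) (hZ : IsTriangularModule k le Z) :
    ∃ P : ProjectiveResolution Z, (∀ n, IsTriangularModule k le (P.complex.X n)) ∧
      ∀ (z : E) (n : ℕ),
        Projective ((peirceFunctor (envMap (f z))).obj (P.complex.X n)) := by
  obtain ⟨P, hP⟩ := exists_projectiveResolution_of_cover
    (fun N : ModuleCat.{v} (Env k Λ) => IsTriangularModule k le N)
    (fun N => ModuleCat.of (Env k Λ) (triangularCover k le N))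
    (fun N => ModuleCat.ofHom (triangularCoverMap k le N))
    (fun N => by
      rw [← IsProjective.iff_projective]
      exact idempotentSum_projective fun i => peirceElt_isIdempotentElem k hE _ _)
    (fun N => triangularCover_isTriangularModule k hle N)
    (fun N hN => (ModuleCat.epi_iff_surjective _).2 (triangularCoverMap_surjective k hE hN))
    (fun {M N} i _ hN x y h m => (ModuleCat.mono_iff_injective i).1 inferInstance (by
      rw [map_smul, map_zero, hN x y h])) Z hZ
  refine ⟨P, fun n => ?_, fun z n => ?_⟩
  · obtain ⟨N, hN⟩ := hP n
    rw [hN]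
    exact triangularCover_isTriangularModule k hle N
  · obtain ⟨N, hN⟩ := hP n
    rw [hN]
    change Projective (ModuleCat.of _ (PeirceComponent _ _))
    rw [← IsProjective.iff_projective]
    exact peirceComponent_triangularCover_projective k hE hle hf hpf hfp N z

end Triangular

section Coinvariants

attribute [local instance] ModuleCat.moduleOfAlgebraModule
attribute [local instance] ModuleCat.isScalarTower_of_algebra_moduleCat

variable (k : Type u) [Field k] (Λ : Type v) [Ring Λ] [Algebra k Λ]

/-- The functor `Λ ⊗_{Λ ⊗ Λᵒᵖ} -`, whose derived functors give Hochschild homology. -/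
def hhFunctor : ModuleCat.{v} (Env k Λ) ⥤ ModuleCat.{v} k :=
  letI := rightEnvModule k Λ
  tensorFunctor k (Env k Λ) Λ

instance : (hhFunctor k Λ).Additive :=
  letI := rightEnvModule k Λ
  tensorFunctor_additive k (Env k Λ) Λ

namespace hhFunctor

variable {k Λ} {N N' : ModuleCat.{v} (Env k Λ)}

/-- The class of `a ⊗ n`. -/
def tmul (a : Λ) (n : N) : (hhFunctor k Λ).obj N :=
  letI := rightEnvModule k Λ
  (Submodule.Quotient.mk (a ⊗ₜ[k] n) : TensorOver k (Env k Λ) Λ N)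

theorem tmul_add (a : Λ) (m n : N) : tmul a (m + n) = tmul a m + tmul a n :=
  letI := rightEnvModule k Λ
  congrArg (Submodule.Quotient.mk (p := balancedRel k (Env k Λ) Λ N)) (TensorProduct.tmul_add a m n)

theorem add_tmul (a b : Λ) (n : N) : tmul (a + b) n = tmul a n + tmul b n :=
  letI := rightEnvModule k Λ
  congrArg (Submodule.Quotient.mk (p := balancedRel k (Env k Λ) Λ N)) (TensorProduct.add_tmul a b n)

theorem tmul_smul (c : k) (a : Λ) (n : N) : tmul a (c • n) = c • tmul a n :=
  letI := rightEnvModule k Λ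
  congrArg (Submodule.Quotient.mk (p := balancedRel k (Env k Λ) Λ N))
    (TensorProduct.tmul_smul c a n)

theorem smul_tmul (c : k) (a : Λ) (n : N) : tmul (c • a) n = c • tmul a n :=
  letI := rightEnvModule k Λ
  congrArg (Submodule.Quotient.mk (p := balancedRel k (Env k Λ) Λ N)) (TensorProduct.smul_tmul' c a n)

theorem tmul_env_smul (a x b : Λ) (n : N) :
    tmul x ((a ⊗ₜ MulOpposite.op b : Env k Λ) • n) = tmul (b * x * a) n := by
  let := rightEnvModule k Λ
  symm
  refine (Submodule.Quotient.eq (balancedRel k (Env k Λ) Λ N)).2 (Submodule.subset_span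
    ⟨x, a ⊗ₜ MulOpposite.op b, n, ?_⟩)
  rw [rightEnvModule_smul, MulOpposite.unop_op]

theorem hom_ext {W : ModuleCat.{v} k} {g h : (hhFunctor k Λ).obj N ⟶ W}
    (H : ∀ (a : Λ) (n : N), g (tmul a n) = h (tmul a n)) : g = h :=
  letI := rightEnvModule k Λ
  ModuleCat.hom_ext (TensorOver.hom_ext k (Env k Λ) H)

/-- A balanced bilinear map induces a map on the tensor product. -/
def desc {W : ModuleCat.{v} k} (B : Λ →ₗ[k] N →ₗ[k] W)
    (hB : ∀ (a x b : Λ) (n : N),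
      B (b * x * a) n = B x ((a ⊗ₜ MulOpposite.op b : Env k Λ) • n)) :
    (hhFunctor k Λ).obj N ⟶ W :=
  letI := rightEnvModule k Λ
  ModuleCat.ofHom (Submodule.liftQ (balancedRel k (Env k Λ) Λ N) (TensorProduct.lift B) (by
    rw [balancedRel, Submodule.span_le]
    rintro _ ⟨x, r, n, rfl⟩
    change TensorProduct.lift B _ = 0
    rw [map_sub, TensorProduct.lift.tmul, TensorProduct.lift.tmul, sub_eq_zero]
    induction r using TensorProduct.induction_on with
    | zero =>
      have h : B (MulOpposite.op (0 : Env k Λ) • x) n = B x ((0 : Env k Λ) • n) := by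
        have h0 : MulOpposite.op (0 : Env k Λ) • x = 0 := zero_smul (Env k Λ)ᵐᵒᵖ x
        have h1 : (0 : Env k Λ) • n = 0 := zero_smul (Env k Λ) n
        rw [h0, h1, map_zero, map_zero, LinearMap.zero_apply]
      exact h
    | add r s hr hs =>
      rw [MulOpposite.op_add, add_smul, add_smul, map_add, map_add, ← hr, ← hs]; rfl
    | tmul a b => rw [rightEnvModule_smul]; exact hB a x b.unop n))

end hhFunctor

end Coinvariants

section Decomposition

attribute [local instance] ModuleCat.moduleOfAlgebraModule
attribute [local instance] ModuleCat.isScalarTower_of_algebra_moduleCat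

variable {k : Type u} [Field k] {A Λ : Type v} [Ring A] [Algebra k A] [Ring Λ] [Algebra k Λ]

theorem PeirceComponent.val_scalar_smul (f : A →ₙₐ[k] Λ) (N : ModuleCat.{v} (Env k Λ)) (c : k)
    (n : (peirceFunctor (envMap f)).obj N) :
    (c • n : (peirceFunctor (envMap f)).obj N).1 = c • n.1 := by
  change envMap f (algebraMap k (Env k A) c) • n.1 = c • n.1
  rw [Algebra.algebraMap_eq_smul_one, map_smul, smul_assoc]
  exact congrArg (c • ·) n.2

/-- The map `A ⊗ φ(1)N → Λ ⊗ N` given by `a ⊗ n ↦ f(a) ⊗ n`. -/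
def hhCornerι (f : A →ₙₐ[k] Λ) (N : ModuleCat.{v} (Env k Λ)) :
    (hhFunctor k A).obj ((peirceFunctor (envMap f)).obj N) ⟶ (hhFunctor k Λ).obj N :=
  hhFunctor.desc
    (LinearMap.mk₂ k (fun a n => hhFunctor.tmul (N := N) (f a) n.1)
      (fun a b n => by rw [map_add, hhFunctor.add_tmul])
      (fun c a n => by rw [map_smul, hhFunctor.smul_tmul])
      (fun a m n => hhFunctor.tmul_add (N := N) (f a) m.1 n.1)
      (fun c a n => by rw [PeirceComponent.val_scalar_smul, hhFunctor.tmul_smul]))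
    (fun a x b n => by
      change hhFunctor.tmul (N := N) (f (b * x * a)) n.1 =
        hhFunctor.tmul (N := N) (f x) ((f a ⊗ₜ MulOpposite.op (f b) : Env k Λ) • n.1)
      rw [hhFunctor.tmul_env_smul, map_mul, map_mul])

/-- The linear map `N → φ(1)N` given by multiplication by `f(1)x ⊗ f(1)`. -/
def peirceProj (f : A →ₙₐ[k] Λ) (N : ModuleCat.{v} (Env k Λ)) (x : Λ) (n : N) :
    (peirceFunctor (envMap f)).obj N :=
  ⟨((f 1 * x) ⊗ₜ MulOpposite.op (f 1) : Env k Λ) • n, by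
    change envMap f 1 • _ = _
    rw [envMap_one, ← mul_smul, Algebra.TensorProduct.tmul_mul_tmul, ← mul_assoc,
      ← MulOpposite.op_mul, ← map_mul, one_mul]⟩

variable {E : Finset Λ} {le : E → E → Prop}

theorem env_smul_corner_left (hE : IsSystem E) (hle : IsPeirceOrder le)
    {N : ModuleCat.{v} (Env k Λ)} (hN : IsTriangularModule k le N) (z : E) (b x : Λ) (n : N) :
    ((z * (b * x) : Λ) ⊗ₜ MulOpposite.op (z : Λ) : Env k Λ) • n =
      ((z * b * z : Λ) ⊗ₜ MulOpposite.op (z : Λ) : Env k Λ) •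
        ((z * x : Λ) ⊗ₜ MulOpposite.op (z : Λ) : Env k Λ) • n := by
  have hsum : (z * (b * x) : Λ) = ∑ w : E, z * b * w * x := by
    rw [← Finset.sum_mul, ← Finset.mul_sum, hE.complete, mul_one, mul_assoc]
  rw [hsum, TensorProduct.sum_tmul, Finset.sum_smul, Finset.sum_eq_single z]
  · rw [← mul_smul, Algebra.TensorProduct.tmul_mul_tmul, ← MulOpposite.op_mul, (hE.idem z).eq,
      ← mul_assoc, mul_assoc _ (z : Λ) (z : Λ), (hE.idem z).eq]
  · intro w _ hw
    by_cases h : (z * b * w : Λ) = 0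
    · rw [h, zero_mul, TensorProduct.zero_tmul]
      exact zero_smul (Env k Λ) n
    · have h' : ¬ le w z := fun h' => hw (hle.antisymm h' (hle.of_ne_zero b h))
      have : ((z * b * w * x : Λ) ⊗ₜ MulOpposite.op (z : Λ) : Env k Λ) =
          ((z * b : Λ) ⊗ₜ 1) * (peirceElt k w z * (x ⊗ₜ 1)) := by
        rw [peirceElt, Algebra.TensorProduct.tmul_mul_tmul, Algebra.TensorProduct.tmul_mul_tmul,
          mul_one, one_mul, mul_assoc (z * b : Λ)]
      rw [this, mul_smul, mul_smul, hN _ _ h', smul_zero]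
  · simp

theorem env_smul_corner_right (hE : IsSystem E) (hle : IsPeirceOrder le)
    {N : ModuleCat.{v} (Env k Λ)} (hN : IsTriangularModule k le N) (z : E) (b x : Λ) (n : N) :
    ((z * x : Λ) ⊗ₜ MulOpposite.op (b * z : Λ) : Env k Λ) • n =
      ((z : Λ) ⊗ₜ MulOpposite.op (z * b * z : Λ) : Env k Λ) •
        ((z * x : Λ) ⊗ₜ MulOpposite.op (z : Λ) : Env k Λ) • n := by
  have hsum : (b * z : Λ) = ∑ w : E, w * (b * z) := by
    rw [← Finset.sum_mul, hE.complete, one_mul]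
  rw [hsum, Finset.op_sum, TensorProduct.tmul_sum, Finset.sum_smul, Finset.sum_eq_single z]
  · rw [← mul_smul, Algebra.TensorProduct.tmul_mul_tmul, ← MulOpposite.op_mul,
      ← mul_assoc (z : Λ) z x, (hE.idem z).eq, mul_assoc (z : Λ) b,
      ← mul_assoc (z : Λ) z, (hE.idem z).eq]
  · intro w _ hw
    by_cases h : (w * b * z : Λ) = 0
    · rw [← mul_assoc, h, MulOpposite.op_zero, TensorProduct.tmul_zero]
      exact zero_smul (Env k Λ) n
    · have h' : ¬ le z w := fun h' => hw (hle.antisymm (hle.of_ne_zero b h) h')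
      have : ((z * x : Λ) ⊗ₜ MulOpposite.op (w * (b * z) : Λ) : Env k Λ) =
          ((1 : Λ) ⊗ₜ MulOpposite.op (b * z : Λ)) * (peirceElt k z w * (x ⊗ₜ 1)) := by
        rw [peirceElt, Algebra.TensorProduct.tmul_mul_tmul, Algebra.TensorProduct.tmul_mul_tmul,
          mul_one, one_mul, MulOpposite.op_mul]
      rw [this, mul_smul, mul_smul, hN _ _ h', smul_zero]
  · simp

/-- For a triangular bimodule `N`, the map `Λ ⊗ N → A ⊗ φ(1)N` given by `x ⊗ n ↦ 1 ⊗ zxnz`, where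
`A` is identified with `zΛz` by `f`. -/
def hhCornerπ (hE : IsSystem E) (hle : IsPeirceOrder le)
    {N : ModuleCat.{v} (Env k Λ)} (hN : IsTriangularModule k le N) (z : E)
    {f : A →ₙₐ[k] Λ} {p : Λ →ₗ[k] A} (hf : f 1 = z)
    (hfp : ∀ b, f (p b) = z * b * z) :
    (hhFunctor k Λ).obj N ⟶ (hhFunctor k A).obj ((peirceFunctor (envMap f)).obj N) :=
  hhFunctor.desc
    (LinearMap.mk₂ k (fun x n => hhFunctor.tmul 1 (peirceProj f N x n))
      (fun x y n => by
        rw [← hhFunctor.tmul_add]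
        refine congrArg _ (Subtype.ext ?_)
        change ((f 1 * (x + y)) ⊗ₜ MulOpposite.op (f 1) : Env k Λ) • n = _ • n + _ • n
        rw [mul_add, TensorProduct.add_tmul, add_smul])
      (fun c x n => by
        rw [← hhFunctor.tmul_smul]
        refine congrArg _ (Subtype.ext ?_)
        rw [PeirceComponent.val_scalar_smul]
        change ((f 1 * (c • x)) ⊗ₜ MulOpposite.op (f 1) : Env k Λ) • n = c • (_ • n)
        rw [mul_smul_comm, ← TensorProduct.smul_tmul', smul_assoc])
      (fun x m n => by
        rw [← hhFunctor.tmul_add]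
        exact congrArg _ (Subtype.ext (smul_add _ m n)))
      (fun c x n => by
        rw [← hhFunctor.tmul_smul]
        refine congrArg _ (Subtype.ext ?_)
        rw [PeirceComponent.val_scalar_smul]
        change ((f 1 * x) ⊗ₜ MulOpposite.op (f 1) : Env k Λ) • (algebraMap k (Env k Λ) c • n) =
          algebraMap k (Env k Λ) c • (((f 1 * x) ⊗ₜ MulOpposite.op (f 1) : Env k Λ) • n)
        rw [← mul_smul, ← mul_smul, Algebra.commutes]))
    (fun a x b n => by
      have h1 : peirceProj f N (b * x * a) n =
          (p b ⊗ₜ MulOpposite.op 1 : Env k A) • peirceProj f N (x * a) n := Subtype.ext (by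
        change ((f 1 * (b * x * a)) ⊗ₜ MulOpposite.op (f 1) : Env k Λ) • n =
          (f (p b) ⊗ₜ MulOpposite.op (f 1) : Env k Λ) •
            ((f 1 * (x * a)) ⊗ₜ MulOpposite.op (f 1) : Env k Λ) • n
        rw [hfp, hf, mul_assoc b, env_smul_corner_left hE hle hN])
      have h2 : peirceProj f N x ((a ⊗ₜ MulOpposite.op b : Env k Λ) • n) =
          (1 ⊗ₜ MulOpposite.op (p b) : Env k A) • peirceProj f N (x * a) n := Subtype.ext (by
        change ((f 1 * x) ⊗ₜ MulOpposite.op (f 1) : Env k Λ) •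
            (a ⊗ₜ MulOpposite.op b : Env k Λ) • n =
          (f 1 ⊗ₜ MulOpposite.op (f (p b)) : Env k Λ) •
            ((f 1 * (x * a)) ⊗ₜ MulOpposite.op (f 1) : Env k Λ) • n
        rw [hfp, hf, ← env_smul_corner_right hE hle hN, ← mul_smul,
          Algebra.TensorProduct.tmul_mul_tmul, ← MulOpposite.op_mul, mul_assoc])
      change hhFunctor.tmul 1 (peirceProj f N (b * x * a) n) = hhFunctor.tmul 1 (peirceProj f N x _)
      rw [h1, h2, hhFunctor.tmul_env_smul, hhFunctor.tmul_env_smul, one_mul, one_mul, mul_one,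
        mul_one])

theorem hhCornerι_π (hE : IsSystem E) (hle : IsPeirceOrder le)
    {N : ModuleCat.{v} (Env k Λ)} (hN : IsTriangularModule k le N) (z : E)
    {f : A →ₙₐ[k] Λ} {p : Λ →ₗ[k] A} (hf : f 1 = z)
    (hfp : ∀ b, f (p b) = z * b * z) :
    hhCornerι f N ≫ hhCornerπ hE hle hN z hf hfp = 𝟙 _ := by
  refine hhFunctor.hom_ext fun a n => ?_
  change hhFunctor.tmul 1 (peirceProj f N (f a) n.1) = hhFunctor.tmul a n
  have : peirceProj f N (f a) n.1 = (a ⊗ₜ MulOpposite.op 1 : Env k A) • n := Subtype.ext (by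
    change ((f 1 * f a) ⊗ₜ MulOpposite.op (f 1) : Env k Λ) • n.1 =
      (f a ⊗ₜ MulOpposite.op (f 1) : Env k Λ) • n.1
    rw [← map_mul, one_mul])
  rw [this, hhFunctor.tmul_env_smul, one_mul, one_mul]

theorem hhCornerι_π_ne (hE : IsSystem E) (hle : IsPeirceOrder le)
    {N : ModuleCat.{v} (Env k Λ)} (hN : IsTriangularModule k le N) {z w : E} (hzw : z ≠ w)
    {f : A →ₙₐ[k] Λ} {p : Λ →ₗ[k] A}
    (hf : f 1 = z) (hfp : ∀ b, f (p b) = z * b * z)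
    {A' : Type v} [Ring A'] [Algebra k A'] {f' : A' →ₙₐ[k] Λ} (hf' : f' 1 = w) :
    hhCornerι f' N ≫ hhCornerπ hE hle hN z hf hfp = 0 := by
  refine hhFunctor.hom_ext fun a n => ?_
  change hhFunctor.tmul 1 (peirceProj f N (f' a) n.1) = 0
  have h0 : (z : Λ) * w = 0 := hE.ortho hzw
  have : peirceProj f N (f' a) n.1 = (0 : k) • peirceProj f N (f' a) n.1 := Subtype.ext (by
    rw [zero_smul]
    change ((f 1 * f' a) ⊗ₜ MulOpposite.op (f 1) : Env k Λ) • n.1 = 0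
    rw [← one_mul a, map_mul, ← mul_assoc, hf, hf', h0, zero_mul, TensorProduct.zero_tmul]
    exact zero_smul (Env k Λ) n.1)
  rw [this, hhFunctor.tmul_smul, zero_smul]

theorem hhCornerπ_ι_apply (hE : IsSystem E) (hle : IsPeirceOrder le)
    {N : ModuleCat.{v} (Env k Λ)} (hN : IsTriangularModule k le N) (z : E)
    {f : A →ₙₐ[k] Λ} {p : Λ →ₗ[k] A} (hf : f 1 = z)
    (hfp : ∀ b, f (p b) = z * b * z) (x : Λ) (n : N) :
    (hhCornerπ hE hle hN z hf hfp ≫ hhCornerι f N) (hhFunctor.tmul x n) =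
      hhFunctor.tmul (z * x) n := by
  change hhFunctor.tmul (f 1) (((f 1 * x) ⊗ₜ MulOpposite.op (f 1) : Env k Λ) • n) = _
  rw [hhFunctor.tmul_env_smul, ← mul_assoc, ← map_mul, ← map_mul, one_mul, one_mul, hf]

theorem moduleCat_sum_apply {ι : Type*} {R : Type u} [Ring R] {M N : ModuleCat.{v} R}
    (g : ι → (M ⟶ N)) (s : Finset ι) (x : M) : (∑ i ∈ s, g i) x = ∑ i ∈ s, g i x :=
  (congrArg (fun h => h x) (ModuleCat.hom_sum g s)).trans (LinearMap.sum_apply s _ x)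

theorem sum_hhCornerπ_ι {A : E → Type v} [∀ z, Ring (A z)] [∀ z, Algebra k (A z)]
    (hE : IsSystem E) (hle : IsPeirceOrder le) {N : ModuleCat.{v} (Env k Λ)}
    (hN : IsTriangularModule k le N) {f : ∀ z, A z →ₙₐ[k] Λ} {p : ∀ z, Λ →ₗ[k] A z}
    (hf : ∀ z, f z 1 = z) (hfp : ∀ z b, f z (p z b) = z * b * z) :
    ∑ z, hhCornerπ hE hle hN z (hf z) (hfp z) ≫ hhCornerι (f z) N = 𝟙 _ := by
  refine hhFunctor.hom_ext fun x n => ?_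
  let T : Λ →+ (hhFunctor k Λ).obj N :=
    AddMonoidHom.mk' (fun y => hhFunctor.tmul y n) fun a b => hhFunctor.add_tmul a b n
  have h : ∑ z : E, T (z * x) = T x := by
    rw [← map_sum, ← Finset.sum_mul, hE.complete, one_mul]
  exact (moduleCat_sum_apply _ _ _).trans <| (Finset.sum_congr rfl fun z _ =>
    hhCornerπ_ι_apply hE hle hN z (hf z) (hfp z) x n).trans h

end Decomposition

section DirectSumIso

variable {k : Type u} [Field k] {ι : Type*} [Fintype ι] [DecidableEq ι]

theorem nonempty_linearEquiv_directSum {X : ModuleCat.{v} k} {Y : ι → ModuleCat.{v} k}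
    (a : ∀ z, Y z ⟶ X) (b : ∀ z, X ⟶ Y z) (hab : ∀ z, a z ≫ b z = 𝟙 _)
    (hne : ∀ z w, z ≠ w → a w ≫ b z = 0) (hsum : ∑ z, b z ≫ a z = 𝟙 X) :
    Nonempty (X ≃ₗ[k] ⨁ z, Y z) := by
  refine ⟨LinearEquiv.ofLinearMap (∑ z, DirectSum.lof k ι (fun z => Y z) z ∘ₗ (b z).hom)
    (DirectSum.toModule k ι X fun z => (a z).hom) ?_ ?_⟩
  · refine DirectSum.linearMap_ext k fun w => LinearMap.ext fun y => ?_
    rw [LinearMap.comp_apply, LinearMap.comp_apply, DirectSum.toModule_lof, LinearMap.sum_apply,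
      Finset.sum_eq_single w]
    · exact congrArg (DirectSum.lof k ι (fun z => Y z) w) (ConcreteCategory.congr_hom (hab w) y)
    · intro z _ h
      have h0 : (b z).hom ((a w).hom y) = 0 := ConcreteCategory.congr_hom (hne z w h) y
      rw [LinearMap.comp_apply, h0, map_zero]
    · simp
  · refine LinearMap.ext fun x => ?_
    rw [LinearMap.comp_apply, LinearMap.sum_apply, map_sum]
    simp only [LinearMap.comp_apply, DirectSum.toModule_lof]
    have h := congrArg (fun g => ModuleCat.Hom.hom g x) hsum
    simpa [ModuleCat.hom_sum] using h

end DirectSumIso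

section Hochschild

variable {k : Type u} [Field k] {Λ : Type v} [Ring Λ] [Algebra k Λ]

section Corner

variable {A : Type v} [Ring A] [Algebra k A]

/-- The Peirce component of `Λ` at an idempotent `z` is `zΛz`, as a bimodule. -/
def peirceSelfEquiv {z : Λ} {f : A →ₙₐ[k] Λ} {p : Λ →ₗ[k] A} (hf : f 1 = z)
    (hpf : ∀ a, p (f a) = a) (hfp : ∀ b, f (p b) = z * b * z) :
    letI := leftEnvModule k Λ
    letI := leftEnvModule k A
    A ≃ₗ[Env k A] PeirceComponent (envMap f) Λ :=
  letI := leftEnvModule k Λ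
  letI := leftEnvModule k A
  { toFun := fun a => ⟨f a, by
      change envMap f 1 • f a = f a
      rw [envMap_one, leftEnvModule_smul, MulOpposite.unop_op, ← map_mul, ← map_mul, one_mul,
        mul_one]⟩
    map_add' := fun a b => Subtype.ext (map_add f a b)
    map_smul' := fun s a => by
      refine Subtype.ext ?_
      change f (s • a) = envMap f s • f a
      induction s using TensorProduct.induction_on with
      | zero =>
        have h : f ((0 : Env k A) • a) = envMap f 0 • f a := by
          have h1 : (0 : Env k A) • a = 0 := zero_smul (Env k A) a
          have h2 : (0 : Env k Λ) • f a = 0 := zero_smul (Env k Λ) (f a)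
          rw [h1, map_zero, map_zero, h2]
        exact h
      | add s t hs ht => rw [add_smul, map_add, hs, ht, map_add, add_smul]
      | tmul b c =>
        rw [leftEnvModule_smul, envMap_tmul, leftEnvModule_smul, map_mul, map_mul,
          MulOpposite.unop_op]
    invFun := fun x => p x.1
    left_inv := hpf
    right_inv := fun x => by
      refine Subtype.ext ((hfp x.1).trans ?_)
      have h : envMap f 1 • x.1 = x.1 := x.2
      rwa [envMap_one, leftEnvModule_smul, MulOpposite.unop_op, hf] at h }

variable {E : Finset Λ} {le : E → E → Prop}

/-- The chain map with components `hhCornerι`. -/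
def hhCornerιComplex (f : A →ₙₐ[k] Λ) (K : ChainComplex (ModuleCat.{v} (Env k Λ)) ℕ) :
    ((hhFunctor k A).mapHomologicalComplex _).obj
      (((peirceFunctor (envMap f)).mapHomologicalComplex _).obj K) ⟶
      ((hhFunctor k Λ).mapHomologicalComplex _).obj K where
  f i := hhCornerι f (K.X i)
  comm' _ _ _ := hhFunctor.hom_ext fun _ _ => rfl

theorem peirceProj_naturality (f : A →ₙₐ[k] Λ) {N N' : ModuleCat.{v} (Env k Λ)} (g : N ⟶ N')
    (x : Λ) (n : N) :
    peirceProj f N' x (g n) = (peirceFunctor (envMap f)).map g (peirceProj f N x n) :=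
  Subtype.ext (map_smul g.hom _ n).symm

/-- The chain map with components `hhCornerπ`. -/
def hhCornerπComplex (hE : IsSystem E) (hle : IsPeirceOrder le)
    {K : ChainComplex (ModuleCat.{v} (Env k Λ)) ℕ} (hK : ∀ n, IsTriangularModule k le (K.X n))
    (z : E) {f : A →ₙₐ[k] Λ} {p : Λ →ₗ[k] A} (hf : f 1 = z) (hfp : ∀ b, f (p b) = z * b * z) :
    ((hhFunctor k Λ).mapHomologicalComplex _).obj K ⟶ ((hhFunctor k A).mapHomologicalComplex _).obj
      (((peirceFunctor (envMap f)).mapHomologicalComplex _).obj K) where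
  f i := hhCornerπ hE hle (hK i) z hf hfp
  comm' i j _ := hhFunctor.hom_ext fun x n =>
    congrArg (hhFunctor.tmul 1) (peirceProj_naturality f (K.d i j) x n).symm

end Corner

variable {E : Finset Λ} {A : E → Type v} [∀ z, Ring (A z)] [∀ z, Algebra k (A z)]

theorem nonempty_HH_linearEquiv_directSum (hE : IsSystem E) {le : E → E → Prop}
    (hle : IsPeirceOrder le) {f : ∀ z, A z →ₙₐ[k] Λ} {p : ∀ z, Λ →ₗ[k] A z}
    (hf : ∀ z, f z 1 = z) (hpf : ∀ z a, p z (f z a) = a) (hfp : ∀ z b, f z (p z b) = z * b * z)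
    (n : ℕ) : Nonempty (HH k Λ n ≃ₗ[k] ⨁ z : E, HH k (A z) n) := by
  classical
  let := leftEnvModule k Λ
  obtain ⟨P, hP, hproj⟩ := exists_triangular_resolution k hE hle hf hpf hfp
    (ModuleCat.of (Env k Λ) Λ) (hle.isTriangularModule_self k)
  let H := HomologicalComplex.homologyFunctor (ModuleCat.{v} k) (ComplexShape.down ℕ) n
  let e : HH k Λ n ≅ H.obj (((hhFunctor k Λ).mapHomologicalComplex _).obj P.complex) :=
    P.isoLeftDerivedObj (hhFunctor k Λ) n
  let e' : ∀ z, HH k (A z) n ≅ H.obj (((hhFunctor k (A z)).mapHomologicalComplex _).obj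
      (((peirceFunctor (envMap (f z))).mapHomologicalComplex _).obj P.complex)) := fun z =>
    letI := leftEnvModule k (A z)
    ((hhFunctor k (A z)).leftDerived n).mapIso
        (peirceSelfEquiv (hf z) (hpf z) (hfp z)).toModuleIso ≪≫
      (P.mapExact (peirceFunctor (envMap (f z))) (hproj z)).isoLeftDerivedObj
        (hhFunctor k (A z)) n
  let a := fun z => H.map (hhCornerιComplex (f z) P.complex)
  let b := fun z => H.map (hhCornerπComplex hE hle hP z (hf z) (hfp z))
  have hab : ∀ z, a z ≫ b z = 𝟙 _ := fun z => by
    rw [← H.map_comp, ← H.map_id]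
    congr 1
    ext i : 1
    exact hhCornerι_π hE hle (hP i) z (hf z) (hfp z)
  have hne : ∀ z w, z ≠ w → a w ≫ b z = 0 := fun z w h => by
    rw [← H.map_comp, ← H.map_zero]
    congr 1
    ext i : 1
    exact hhCornerι_π_ne hE hle (hP i) h (hf z) (hfp z) (hf w)
  have hsum : ∑ z, b z ≫ a z = 𝟙 _ := by
    simp only [a, b, ← H.map_comp]
    rw [← H.map_sum, ← H.map_id]
    congr 1
    ext i : 1
    refine (map_sum (HomologicalComplex.Hom.fAddMonoidHom i) _ _).trans ?_
    exact sum_hhCornerπ_ι hE hle (hP i) hf hfp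
  exact nonempty_linearEquiv_directSum (fun z => (e' z).hom ≫ a z ≫ e.inv)
    (fun z => e.hom ≫ b z ≫ (e' z).inv)
    (fun z => by simp [reassoc_of% hab z])
    (fun z w h => by simp [reassoc_of% hne z w h])
    (by
      have : ∀ z, (e.hom ≫ b z ≫ (e' z).inv) ≫ (e' z).hom ≫ a z ≫ e.inv =
        e.hom ≫ (b z ≫ a z) ≫ e.inv := fun z => by simp
      simp only [this]
      rw [← Preadditive.comp_sum, ← Preadditive.sum_comp, hsum]
      simp)

end Hochschild

section Corner

variable (k : Type u) [Field k] {Λ : Type v} [Ring Λ] [Algebra k Λ] {e : Λ}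

/-- The inclusion of `eΛe` in `Λ`. -/
def cornerIncl (he : IsIdempotentElem e) : he.Corner →ₙₐ[k] Λ where
  toFun a := a.1
  map_smul' _ _ := rfl
  map_zero' := rfl
  map_add' _ _ := rfl
  map_mul' _ _ := rfl

/-- The projection `a ↦ eae` of `Λ` on `eΛe`. -/
def cornerProj (he : IsIdempotentElem e) : Λ →ₗ[k] he.Corner where
  toFun a := ⟨e * a * e, a, rfl⟩
  map_add' a b := Subtype.ext (by
    change e * (a + b) * e = e * a * e + e * b * e
    rw [mul_add, add_mul])
  map_smul' c a := Subtype.ext (by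
    change e * (c • a) * e = c • (e * a * e)
    rw [mul_smul_comm, smul_mul_assoc])

theorem cornerProj_cornerIncl (he : IsIdempotentElem e) (a : he.Corner) :
    cornerProj k he (cornerIncl k he a) = a := by
  refine Subtype.ext ?_
  have h := (Subsemigroup.mem_corner_iff he).1 a.2
  change e * a.1 * e = a.1
  rw [h.1, h.2]

end Corner
end

theorem mainTheorem11 {k : Type*} [Field k] {Λ : Type*} [Ring Λ] [Algebra k Λ]
    (E : Finset Λ) (hE : IsSystem E) (hΛ : IsTriangular E) :
    ∀ n : ℕ, Nonempty (HH k Λ n ≃ₗ[k] ⨁ x : E, HH k (hE.idem x).Corner n) := by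
  obtain ⟨le, hle⟩ := hΛ.exists_isPeirceOrder
  exact nonempty_HH_linearEquiv_directSum hE hle (f := fun z => cornerIncl k (hE.idem z))
    (p := fun z => cornerProj k (hE.idem z)) (fun _ => rfl)
    (fun z a => cornerProj_cornerIncl k (hE.idem z) a) (fun _ _ => rfl)
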